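/- Throughout, $C_k(Z)$ is the space of continuous functions $Z\to\mathbb R$ with the compact-open topology. A topological space $Z$ is *$\kappa$-Fréchet–Urysohn* if for every open $U\subseteq Z$ and every $x\in\overline U$ some sequence in $U$ converges to $x$. A Tychonoff space $Z$ is *Ascoli* if for every compact $K\subseteq C_k(Z)$ the evaluation map $K\times Z\to\mathbb R$, $(f,x)\mapsto f(x)$, is continuous; it is *sequentially Ascoli* if every convergent sequence in $C_k(Z)$ is equicontinuous. A topological space $X$ has *property $(\kappa)$* if every sequence $(A_n)_{n\in\mathbb N}$ of pairwise disjoint finite subsets of $X$ has a subsequence $(A_{n_j})_{j\in\mathbb N}$ for which there are open sets $U_j\supseteq A_{n_j}$ such that every point of $X$ lies in only finitely many of the $U_j$. Let $Y$ be a non-trivial metrizable locally convex space (over $\mathbb R$ or $\mathbb C$), and let $X$ be a Tychonoff space. Let $E$ be one of the following three spaces, with the topology of pointwise convergence: the space $C_p(X,Y)$ of all continuous functions $X\to Y$; the space $C^b_p(X,Y)$ of all continuous $f:X\to Y$ with $f(X)$ bounded in $Y$; the space $C^{rc}_p(X,Y)$ of all continuous $f:X\to Y$ with $f(X)$ relatively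 compact in $Y$. Powers $E^\lambda$ carry the product topology. Then the following assertions are equivalent: 1. $E$ is $\kappa$-Fréchet–Urysohn; 2. $E^\lambda$ is $\kappa$-Fréchet–Urysohn for every cardinal $\lambda>0$; 3. $E$ is Ascoli; 4. $E^\lambda$ is Ascoli for every cardinal $\lambda>0$; 5. $E$ is sequentially Ascoli; 6. $E^\lambda$ is sequentially Ascoli for every cardinal $\lambda>0$; 7. $X$ is finite or has property $(\kappa)$; 8. $E^\lambda$ is $\kappa$-Fréchet–Urysohn for some cardinal $\lambda>0$; 9. $E^\lambda$ is Ascoli for some cardinal $\lambda>0$; 10. $E^\lambda$ is sequentially Ascoli for some cardinal $\lambda>0$. In particular, $C_p(X)=C_p(X,\mathbb R)$ is sequentially Ascoli if and only if $X$ has property $(\kappa)$. -/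

import Mathlib

open Set Filter Topology

universe u v w z

/-- A topological space is `κ`-Fréchet–Urysohn if every point of the closure of an open set `U`
is the limit of a sequence of points of `U`. -/
def IsKappaFrechetUrysohn (Z : Type*) [TopologicalSpace Z] : Prop :=
  ∀ U : Set Z, IsOpen U → ∀ x ∈ closure U,
    ∃ s : ℕ → Z, (∀ n, s n ∈ U) ∧ Tendsto s atTop (𝓝 x)

/-- A set `K` of continuous functions from `Z` to `ℝ` is evenly continuous if the evaluation map
`K × Z → ℝ` is continuous, where `K` carries the topology induced from the compact-open topology
(the topology of Mathlib's `C(Z, ℝ)`). -/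
def EvenlyContinuous {Z : Type*} [TopologicalSpace Z] (K : Set C(Z, ℝ)) : Prop :=
  Continuous fun p : K × Z => (p.1 : C(Z, ℝ)) p.2

/-- A space is Ascoli if it is Tychonoff and every compact set of real-valued continuous functions
(for the compact-open topology) is evenly continuous. -/
structure IsAscoli (Z : Type*) [TopologicalSpace Z] : Prop where
  tychonoff : T35Space Z
  evenlyContinuous : ∀ K : Set C(Z, ℝ), IsCompact K → EvenlyContinuous K

/-- A space is sequentially Ascoli if it is Tychonoff and every sequence of real-valued continuous
functions that converges in the compact-open topology is equicontinuous. -/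
structure IsSequentiallyAscoli (Z : Type*) [TopologicalSpace Z] : Prop where
  tychonoff : T35Space Z
  equicontinuous : ∀ (f : ℕ → C(Z, ℝ)) (g : C(Z, ℝ)), Tendsto f atTop (𝓝 g) →
    Equicontinuous fun n => (f n : Z → ℝ)

/-- A family of sets is point-finite if every point belongs to only finitely many members. -/
def PointFinite {X ι : Type*} (U : ι → Set X) : Prop :=
  ∀ x, {i | x ∈ U i}.Finite

/-- A family of sets is strongly point-finite if its members can be enlarged to open sets that
form a point-finite family. -/
def StronglyPointFinite {X ι : Type*} [TopologicalSpace X] (A : ι → Set X) : Prop :=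
  ∃ U : ι → Set X, (∀ i, IsOpen (U i)) ∧ (∀ i, A i ⊆ U i) ∧ PointFinite U

/-- Property `(κ)`: every pairwise disjoint sequence of finite sets has a strongly point-finite
subsequence. -/
def PropertyKappa (X : Type*) [TopologicalSpace X] : Prop :=
  ∀ A : ℕ → Set X, (∀ n, (A n).Finite) → Pairwise (fun m n => Disjoint (A m) (A n)) →
    ∃ φ : ℕ → ℕ, StrictMono φ ∧ StronglyPointFinite fun j => A (φ j)

/-- `C_p(X, Y)`: all continuous functions. As a set of functions `X → Y`, its subspace topology
is the topology of pointwise convergence; the same holds for the two sets below. -/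
def Cp (X Y : Type*) [TopologicalSpace X] [TopologicalSpace Y] : Set (X → Y) :=
  {f | Continuous f}

/-- `C^b_p(X, Y)`: the continuous functions whose image is bounded in the topological vector
space `Y`. -/
def Cpb (𝕜 X Y : Type*) [RCLike 𝕜] [TopologicalSpace X] [AddCommGroup Y] [Module 𝕜 Y]
    [TopologicalSpace Y] : Set (X → Y) :=
  {f | Continuous f ∧ Bornology.IsVonNBounded 𝕜 (range f)}

/-- `C^rc_p(X, Y)`: the continuous functions whose image is relatively compact in `Y`. -/
def Cprc (X Y : Type*) [TopologicalSpace X] [TopologicalSpace Y] : Set (X → Y) :=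
  {f | Continuous f ∧ IsCompact (closure (range f))}

variable {X Y : Type*} [TopologicalSpace X] [TopologicalSpace Y]

/-! The implications κ-Fréchet–Urysohn ⇒ Ascoli ⇒ sequentially Ascoli hold in every Tychonoff space,
and the properties pass from a power to its factor. So two implications about function spaces carry
the theorem. The three choices of `E` enter only through `IsInterpolative`, which permits gluing two
functions by a `[0,1]`-valued cutoff.

From sequentially Ascoli to `(κ)` (`IsInterpolative.propertyKappa`): attach to disjoint finite sets
`A n` functionals on `E` that detect values of size about `n` on all of `A n`. They cannot tend to
zero, since equicontinuity at `0` would then fail. Hence some compact `K ⊆ E` contains functions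
that are large on infinitely many `A n`. The open sets where these are large are point-finite
because `K` is pointwise bounded.

From `(κ)` to κ-Fréchet–Urysohn powers (`IsInterpolative.isKappaFrechetUrysohn_pi`): choose members
of `U` ever closer to `p` on growing finite sets. Membership of each in `U` depends on finitely many
further points. Property `(κ)` puts these in point-finite open sets, and a cutoff restores `p` away
from them without leaving `U`. -/

/-! ### Implications valid in arbitrary spaces -/

/-- A compact set of functions is equicontinuous on a `κ`-Fréchet–Urysohn space. -/
theorem IsKappaFrechetUrysohn.eventually_dist_le {Z : Type*} [TopologicalSpace Z]
    (hZ : IsKappaFrechetUrysohn Z) {K : Set C(Z, ℝ)} (hK : IsCompact K) (z₀ : Z) {ε : ℝ}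
    (hε : 0 < ε) : ∀ᶠ z in 𝓝 z₀, ∀ f ∈ K, dist (f z) (f z₀) ≤ ε := by
  by_contra hcon
  set O : Set Z := ⋃ f ∈ K, {z | ε < dist (f z) (f z₀)} with hO
  have hOo : IsOpen O := by
    refine isOpen_biUnion fun f _ => isOpen_lt continuous_const ?_
    exact (map_continuous f).dist continuous_const
  have hz : z₀ ∈ closure O := by
    rw [mem_closure_iff_frequently]
    refine (not_eventually.1 hcon).mono fun z hz => ?_
    push Not at hz
    obtain ⟨f, hf, hfz⟩ := hz
    exact mem_iUnion₂.2 ⟨f, hf, hfz⟩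
  obtain ⟨s, hsO, hs⟩ := hZ O hOo z₀ hz
  have hex : ∀ n, ∃ f ∈ K, ε < dist (f (s n)) (f z₀) := fun n => by
    obtain ⟨f, hf, h⟩ := mem_iUnion₂.1 (hsO n)
    exact ⟨f, hf, h⟩
  choose f hfK hf using hex
  obtain ⟨g, -, hg⟩ := hK.exists_mapClusterPt (f := atTop) (u := f)
    (tendsto_principal.2 (Eventually.of_forall hfK))
  -- A convergent sequence together with its limit is compact, so compact-open closeness to `g` is
  -- uniform along it.
  have hnear : ∀ᶠ h : C(Z, ℝ) in 𝓝 g, ∀ z ∈ insert z₀ (range s), dist (g z) (h z) < ε / 3 :=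
    Metric.tendstoUniformlyOn_iff.1
      (ContinuousMap.tendsto_iff_forall_isCompact_tendstoUniformlyOn.1
        (tendsto_id (x := 𝓝 g)) _ hs.isCompact_insert_range) _ (by positivity)
  have hgs : ∀ᶠ n in atTop, dist (g (s n)) (g z₀) < ε / 3 :=
    Metric.tendsto_nhds.1 (((map_continuous g).tendsto z₀).comp hs) _ (by positivity)
  obtain ⟨n, hn, hn'⟩ := ((hg.frequently hnear).and_eventually hgs).exists
  have h1 := hn (s n) (mem_insert_of_mem _ (mem_range_self n))
  have h2 := hn z₀ (mem_insert _ _)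
  have h3 := hf n
  rw [Real.dist_eq] at *
  rw [abs_lt] at *
  rw [lt_abs] at h3
  rcases h3 with h3 | h3 <;> linarith

theorem IsKappaFrechetUrysohn.isAscoli {Z : Type*} [TopologicalSpace Z] [T35Space Z]
    (hZ : IsKappaFrechetUrysohn Z) : IsAscoli Z where
  tychonoff := inferInstance
  evenlyContinuous K hK := by
    refine continuous_iff_continuousAt.2 fun ⟨f₀, z₀⟩ => ?_
    rw [ContinuousAt, Metric.tendsto_nhds]
    intro ε hε
    have h1 : ∀ᶠ p : K × Z in 𝓝 (f₀, z₀), ∀ f ∈ K, dist (f p.2) (f z₀) ≤ ε / 2 :=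
      (continuous_snd.tendsto (f₀, z₀)).eventually
        (hZ.eventually_dist_le hK z₀ (half_pos hε))
    have h2 : ∀ᶠ p : K × Z in 𝓝 (f₀, z₀),
        dist ((p.1 : C(Z, ℝ)) z₀) ((f₀ : C(Z, ℝ)) z₀) < ε / 2 := by
      have hc : Continuous fun p : K × Z => (p.1 : C(Z, ℝ)) z₀ :=
        (ContinuousEvalConst.continuous_eval_const z₀).comp (continuous_subtype_val.comp continuous_fst)
      exact Metric.tendsto_nhds.1 (hc.tendsto (f₀, z₀)) _ (half_pos hε)
    filter_upwards [h1, h2] with p hp1 hp2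
    have := hp1 p.1 p.1.2
    have := dist_triangle ((p.1 : C(Z, ℝ)) p.2) ((p.1 : C(Z, ℝ)) z₀) ((f₀ : C(Z, ℝ)) z₀)
    linarith

theorem IsAscoli.isSequentiallyAscoli {Z : Type*} [TopologicalSpace Z] (hZ : IsAscoli Z) :
    IsSequentiallyAscoli Z where
  tychonoff := hZ.tychonoff
  equicontinuous f g hfg := by
    set K : Set C(Z, ℝ) := insert g (range f)
    have hK : IsCompact K := hfg.isCompact_insert_range
    have : CompactSpace K := isCompact_iff_compactSpace.1 hK
    have hev : Continuous fun p : K × Z => (p.1 : C(Z, ℝ)) p.2 := hZ.evenlyContinuous K hK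
    intro z₀
    rw [Metric.equicontinuousAt_iff_right]
    intro ε hε
    have hc : Continuous fun p : Z × K => dist ((p.2 : C(Z, ℝ)) z₀) ((p.2 : C(Z, ℝ)) p.1) := by
      refine Continuous.dist ?_ (hev.comp continuous_swap)
      exact hev.comp (continuous_snd.prodMk continuous_const)
    -- Compactness of `K` (the tube lemma) makes the neighbourhood of `z₀` independent of the
    -- function.
    have h := isCompact_univ.eventually_forall_of_forall_eventually (K := (univ : Set K))
      (x₀ := z₀) (P := fun z k => dist ((k : C(Z, ℝ)) z₀) ((k : C(Z, ℝ)) z) < ε)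
      fun k _ => (hc.tendsto (z₀, k)).eventually_lt_const (by simpa using hε)
    filter_upwards [h] with z hz n
    exact hz ⟨f n, mem_insert_of_mem _ (mem_range_self n)⟩ trivial

/-- `Z` is a retract of its power: the diagonal is a section of each coordinate projection. -/
theorem IsKappaFrechetUrysohn.of_pi {Z ι : Type*} [TopologicalSpace Z] [Nonempty ι]
    (h : IsKappaFrechetUrysohn (ι → Z)) : IsKappaFrechetUrysohn Z := by
  intro U hU x hx
  obtain ⟨i⟩ := ‹Nonempty ι›
  have hc : Continuous fun z : Z => (fun _ : ι => z) := continuous_pi fun _ => continuous_id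
  obtain ⟨s, hs, hlim⟩ := h ((fun p => p i) ⁻¹' U) (hU.preimage (continuous_apply i))
    (fun _ => x) (map_mem_closure hc hx fun z hz => hz)
  exact ⟨fun n => s n i, hs, ((continuous_apply i).tendsto _).comp hlim⟩

theorem IsSequentiallyAscoli.of_pi {Z ι : Type*} [TopologicalSpace Z] [T35Space Z] [Nonempty ι]
    (h : IsSequentiallyAscoli (ι → Z)) : IsSequentiallyAscoli Z where
  tychonoff := inferInstance
  equicontinuous f g hfg := by
    obtain ⟨i⟩ := ‹Nonempty ι›
    let p : C(ι → Z, Z) := ⟨fun q => q i, continuous_apply i⟩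
    have hc : Continuous fun z : Z => (fun _ : ι => z) := continuous_pi fun _ => continuous_id
    have he := h.equicontinuous (fun n => (f n).comp p) (g.comp p)
      (((ContinuousMap.continuous_precomp p).tendsto g).comp hfg)
    intro z₀ V hV
    exact (hc.tendsto z₀).eventually (he (fun _ => z₀) V hV)

/-- Only finitely many disjoint subsets can be nonempty; beyond the last of them, empty open sets
suffice. -/
theorem Finite.propertyKappa [Finite X] : PropertyKappa X := by
  intro A _ hd
  have hfin : {n | (A n).Nonempty}.Finite := by
    choose a ha using fun n : {n | (A n).Nonempty} => n.2
    have hinj : Function.Injective a := fun m n hmn => by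
      by_contra hne
      exact disjoint_left.1 (hd fun h => hne (Subtype.ext h)) (ha m) (hmn ▸ ha n)
    exact Finite.of_injective a hinj
  obtain ⟨N, hN⟩ := hfin.bddAbove
  refine ⟨fun j => N + 1 + j, strictMono_id.const_add _, fun _ => ∅, fun _ => isOpen_empty,
    fun j => ?_, fun x => by simp⟩
  rw [subset_empty_iff]
  by_contra hne
  have := hN (show N + 1 + j ∈ {n | (A n).Nonempty} from nonempty_iff_ne_empty.2 hne)
  omega

/-! ### Finite sets and neighbourhoods in function spaces -/

/-- In a completely regular space a finite set is separated from the complement of any of its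
open neighbourhoods by a continuous function. -/
theorem exists_continuous_one_zero_of_finset_subset [CompletelyRegularSpace X] (D : Finset X)
    {O : Set X} (hO : IsOpen O) (hD : ↑D ⊆ O) :
    ∃ φ : X → ℝ, Continuous φ ∧ (∀ x, φ x ∈ Icc (0 : ℝ) 1) ∧ (∀ x ∈ D, φ x = 1) ∧
      ∀ x ∉ O, φ x = 0 := by
  choose! f hfc hf0 hf1 using fun (d : X) (hd : d ∈ D) =>
    CompletelyRegularSpace.completely_regular_isOpen d O hO (hD hd)
  refine ⟨fun x => 1 - ∏ d ∈ D, (f d x : ℝ), ?_, fun x => ⟨?_, ?_⟩, fun x hx => ?_,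
    fun x hx => ?_⟩
  · exact continuous_const.sub (continuous_finsetProd _ fun d hd =>
      continuous_subtype_val.comp (hfc d hd))
  · exact sub_nonneg.2 (Finset.prod_le_one (fun d _ => (f d x).2.1) fun d _ => (f d x).2.2)
  · exact sub_le_self _ (Finset.prod_nonneg fun d _ => (f d x).2.1)
  · have h : ∏ d ∈ D, (f d x : ℝ) = 0 := Finset.prod_eq_zero hx (by simp [hf0 x hx])
    simp [h]
  · have h : ∏ d ∈ D, (f d x : ℝ) = 1 := Finset.prod_eq_one fun d hd => by simp [hf1 d hd hx]
    simp [h]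

theorem exists_finset_forall_eqOn_mem {X Y : Type*} [TopologicalSpace Y] {E : Set (X → Y)} {U : Set E} (hU : IsOpen U) {f : E}
    (hf : f ∈ U) : ∃ D : Finset X, ∀ g : E, (∀ x ∈ D, g.1 x = f.1 x) → g ∈ U := by
  obtain ⟨W, hW, rfl⟩ := isOpen_induced_iff.1 hU
  obtain ⟨D, u, hu, hDu⟩ := isOpen_pi_iff.1 hW f.1 hf
  exact ⟨D, fun g hg => hDu fun x hx => by rw [hg x hx]; exact (hu x hx).2⟩

theorem exists_finset_forall_eqOn_mem_pi {X Y ι : Type*} [TopologicalSpace Y] {E : Set (X → Y)} {U : Set (ι → E)}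
    (hU : IsOpen U) {f : ι → E} (hf : f ∈ U) :
    ∃ (I : Finset ι) (D : Finset X), ∀ g : ι → E,
      (∀ i ∈ I, ∀ x ∈ D, (g i).1 x = (f i).1 x) → g ∈ U := by
  classical
  obtain ⟨I, u, hu, hIu⟩ := isOpen_pi_iff.1 hU f hf
  choose! D hD using fun i (hi : i ∈ I) => exists_finset_forall_eqOn_mem (hu i hi).1 (hu i hi).2
  exact ⟨I, I.biUnion D, fun g hg => hIu fun i hi => hD i hi (g i) fun x hx =>
    hg i hi x (Finset.mem_biUnion.2 ⟨i, hi, hx⟩)⟩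

/-! ### Interpolative function spaces -/

variable [AddCommGroup Y] [Module ℝ Y]

/-- A set of continuous functions containing the constants and closed under convex combinations
with continuous coefficients. -/
structure IsInterpolative (E : Set (X → Y)) : Prop where
  continuous : ∀ f ∈ E, Continuous f
  const_mem : ∀ y : Y, (fun _ => y) ∈ E
  interpolate_mem : ∀ f ∈ E, ∀ h ∈ E, ∀ φ : X → ℝ, Continuous φ → (∀ x, φ x ∈ Icc (0 : ℝ) 1) →
    (fun x => h x + φ x • (f x - h x)) ∈ E

theorem isInterpolative_Cp [IsTopologicalAddGroup Y] [ContinuousSMul ℝ Y] :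
    IsInterpolative (Cp X Y) where
  continuous _ hf := hf
  const_mem _ := continuous_const
  interpolate_mem _ hf _ hh _ hφ _ := hh.add (hφ.smul (hf.sub hh))

theorem isInterpolative_Cprc [IsTopologicalAddGroup Y] [ContinuousSMul ℝ Y] [T2Space Y] :
    IsInterpolative (Cprc X Y) where
  continuous _ hf := hf.1
  const_mem y := ⟨continuous_const,
    isCompact_singleton.closure_of_subset (range_subset_iff.2 fun _ => rfl)⟩
  interpolate_mem f hf h hh φ hφ hφI := by
    refine ⟨hh.1.add (hφ.smul (hf.1.sub hh.1)), ?_⟩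
    have hK := (isCompact_Icc (a := (0 : ℝ)) (b := 1)).prod (hf.2.prod hh.2)
    have hc : Continuous fun p : ℝ × Y × Y => p.2.2 + p.1 • (p.2.1 - p.2.2) := by fun_prop
    refine (hK.image hc).closure_of_subset (range_subset_iff.2 fun x => ?_)
    exact ⟨(φ x, f x, h x), ⟨hφI x, subset_closure (mem_range_self x),
      subset_closure (mem_range_self x)⟩, rfl⟩

/-- Absorption by a balanced neighbourhood passes to balanced hulls. This keeps `φ x • (f x - h x)`
in a bounded set when `φ` is `[0,1]`-valued. -/
theorem Bornology.IsVonNBounded.balancedHull {𝕜 F : Type*} [NontriviallyNormedField 𝕜]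
    [AddCommGroup F] [Module 𝕜 F] [TopologicalSpace F] [ContinuousSMul 𝕜 F] {S : Set F}
    (hS : Bornology.IsVonNBounded 𝕜 S) : Bornology.IsVonNBounded 𝕜 (balancedHull 𝕜 S) := by
  refine (nhds_basis_balanced 𝕜 F).isVonNBounded_iff.2 fun V hV => ?_
  have h : Absorbs 𝕜 V S := hS hV.1
  exact Filter.Eventually.mono h fun a ha => (hV.2.smul a).balancedHull_subset_of_subset ha

theorem isInterpolative_Cpb {𝕜 : Type*} [RCLike 𝕜] [Module 𝕜 Y] [IsScalarTower ℝ 𝕜 Y]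
    [IsTopologicalAddGroup Y] [ContinuousSMul 𝕜 Y] [ContinuousSMul ℝ Y] :
    IsInterpolative (Cpb 𝕜 X Y) where
  continuous _ hf := hf.1
  const_mem y := ⟨continuous_const,
    (Bornology.isVonNBounded_singleton y).subset
      (range_subset_iff.2 fun _ => mem_singleton _)⟩
  interpolate_mem f hf h hh φ hφ hφI := by
    refine ⟨hh.1.add (hφ.smul (hf.1.sub hh.1)), ?_⟩
    refine (hh.2.add (hf.2.sub hh.2).balancedHull).subset (range_subset_iff.2 fun x => ?_)
    refine add_mem_add (mem_range_self x) (mem_balancedHull_iff.2 ⟨(φ x : 𝕜), ?_, ?_⟩)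
    · rw [RCLike.norm_ofReal, abs_le]
      exact ⟨by linarith [(hφI x).1], (hφI x).2⟩
    · refine ⟨f x - h x, sub_mem_sub (mem_range_self x) (mem_range_self x), ?_⟩
      exact algebraMap_smul 𝕜 (φ x) (f x - h x)

/-- A function in `E` with prescribed value on a finite set and vanishing on another. -/
theorem IsInterpolative.exists_eq_of_mem [CompletelyRegularSpace X] [T1Space X] {E : Set (X → Y)}
    (hE : IsInterpolative E) (A D : Finset X) (hAD : Disjoint A D) (y : Y) :
    ∃ f ∈ E, (∀ x ∈ A, f x = y) ∧ ∀ x ∈ D, f x = 0 := by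
  obtain ⟨φ, hφ, hφI, hφA, hφD⟩ := exists_continuous_one_zero_of_finset_subset A
    (O := (D : Set X)ᶜ) D.finite_toSet.isClosed.isOpen_compl
    fun x hx hxD => Finset.disjoint_left.1 hAD hx hxD
  refine ⟨_, hE.interpolate_mem _ (hE.const_mem y) _ (hE.const_mem 0) φ hφ hφI,
    fun x hx => ?_, fun x hx => ?_⟩
  · simp [hφA x hx]
  · simp [hφD x (fun h => h hx)]

/-! ### Property `(κ)` and the topology of interpolative spaces -/

/-- If `E` is sequentially Ascoli, then `X` has property `(κ)`. -/
theorem IsInterpolative.propertyKappa [T35Space X] [IsTopologicalAddGroup Y] [ContinuousSMul ℝ Y]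
    [LocallyConvexSpace ℝ Y] [T1Space Y] [Nontrivial Y] {E : Set (X → Y)}
    (hE : IsInterpolative E) (hA : IsSequentiallyAscoli E) : PropertyKappa X := by
  classical
  intro A hAf hAd
  obtain ⟨χ, y₀, hy₀⟩ : ∃ (χ : Y →L[ℝ] ℝ) (y₀ : Y), χ y₀ = 1 := by
    obtain ⟨y, hy⟩ := exists_ne (0 : Y)
    obtain ⟨χ, hχ⟩ := geometric_hahn_banach_point_point hy.symm
    rw [map_zero] at hχ
    exact ⟨χ, (χ y)⁻¹ • y, by simp [hχ.ne']⟩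
  let B : ℕ → Finset X := fun n => (hAf n).toFinset
  -- The cap at `1` lets a lower bound on the product pass to each factor; the denominator makes the
  -- required values on `A n` grow with `n`.
  let F : ℕ → C(E, ℝ) := fun n =>
    ⟨fun f => ∏ a ∈ B n, min 1 (|χ (f.1 a)| / (n + 1)), by
      refine continuous_finsetProd _ fun a _ => continuous_const.min (Continuous.div_const ?_ _)
      exact (χ.continuous.comp ((continuous_apply a).comp continuous_subtype_val)).abs⟩
  have hFapp : ∀ n f, F n f = ∏ a ∈ B n, min 1 (|χ (f.1 a)| / (n + 1)) := fun _ _ => rfl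
  have hterm : ∀ (n : ℕ) (f : E) (a : X), 0 ≤ min 1 (|χ (f.1 a)| / (n + 1)) :=
    fun n f a => le_min zero_le_one (by positivity)
  have hF0 : ∀ n f, 0 ≤ F n f := fun n f => Finset.prod_nonneg fun a _ => hterm n f a
  by_cases hlim : Tendsto F atTop (𝓝 0)
  · exfalso
    let z : E := ⟨fun _ => 0, hE.const_mem 0⟩
    have heq := Metric.equicontinuousAt_iff_right.1 (hA.equicontinuous F 0 hlim z) 1 one_pos
    obtain ⟨U, hUs, hUo, hzU⟩ := mem_nhds_iff.1 heq
    obtain ⟨D, hD⟩ := exists_finset_forall_eqOn_mem hUo hzU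
    have hlarge : ∀ᶠ n in atTop, Disjoint (B n) D := by
      have hfin : ∀ d ∈ D, ∀ᶠ n in atTop, d ∉ B n := fun d _ => by
        by_cases hex : ∃ m, d ∈ A m
        · obtain ⟨m, hm⟩ := hex
          filter_upwards [eventually_gt_atTop m] with n hn hdn
          exact disjoint_left.1 (hAd hn.ne) hm ((hAf n).mem_toFinset.1 hdn)
        · exact Eventually.of_forall fun n hn => hex ⟨n, (hAf n).mem_toFinset.1 hn⟩
      filter_upwards [(Filter.eventually_all_finset D).2 hfin] with n hn
      exact Finset.disjoint_right.2 hn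
    -- An empty `A n` gives the empty product `1`; this bound excludes that case.
    have hz1 : ∀ᶠ n in atTop, F n z < 1 := by
      have ht : Tendsto (fun n => F n z) atTop (𝓝 0) :=
        ((ContinuousEvalConst.continuous_eval_const z).tendsto (0 : C(E, ℝ))).comp hlim
      exact ht.eventually_lt_const one_pos
    obtain ⟨n, hn, hnz⟩ := (hlarge.and hz1).exists
    obtain ⟨f, hfE, hfA, hfD⟩ := hE.exists_eq_of_mem (B n) D hn ((n + 1 : ℝ) • y₀)
    have hfU := hUs (hD ⟨f, hfE⟩ hfD) n
    have hpos : (0 : ℝ) < n + 1 := by positivity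
    have hf1 : F n ⟨f, hfE⟩ = 1 := by
      rw [hFapp]
      refine Finset.prod_eq_one fun a ha => ?_
      simp only [hfA a ha, map_smul, hy₀, smul_eq_mul, mul_one]
      rw [abs_of_pos hpos, div_self hpos.ne', min_self]
    have hBn : (B n).Nonempty := by
      by_contra hemp
      rw [Finset.not_nonempty_iff_eq_empty] at hemp
      simp [hFapp, hemp] at hnz
    obtain ⟨a, ha⟩ := hBn
    have hz0 : F n z = 0 := by
      rw [hFapp]
      exact Finset.prod_eq_zero ha (by simp [z])
    rw [hf1, hz0] at hfU
    simp at hfU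
  · rw [ContinuousMap.tendsto_iff_forall_isCompact_tendstoUniformlyOn] at hlim
    push Not at hlim
    obtain ⟨K, hK, hnot⟩ := hlim
    rw [Metric.tendstoUniformlyOn_iff] at hnot
    push Not at hnot
    obtain ⟨δ, hδ, hfreq⟩ := hnot
    obtain ⟨φ, hφ, hφf⟩ := extraction_of_frequently_atTop hfreq
    choose f hfK hf using hφf
    have hge : ∀ k, ∀ a ∈ A (φ k), δ * (φ k + 1) ≤ |χ ((f k).1 a)| := by
      intro k a ha
      have haB : a ∈ B (φ k) := (hAf _).mem_toFinset.2 ha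
      have h1 : δ ≤ F (φ k) (f k) := by
        have := hf k
        rwa [ContinuousMap.zero_apply, dist_comm, Real.dist_0_eq_abs, abs_of_nonneg (hF0 _ _)]
          at this
      have h2 : F (φ k) (f k) ≤ min 1 (|χ ((f k).1 a)| / (φ k + 1)) := by
        rw [hFapp, ← Finset.mul_prod_erase _ _ haB]
        exact mul_le_of_le_one_right (hterm _ _ _)
          (Finset.prod_le_one (fun b _ => hterm _ _ _) fun b _ => min_le_left _ _)
      have hpos : (0 : ℝ) < φ k + 1 := by positivity
      exact (le_div_iff₀ hpos).1 ((h1.trans h2).trans (min_le_right _ _))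
    -- Halving `δ` makes the inequality strict on `A (φ k)`. The thresholds tend to infinity while
    -- `K` is bounded at each `x`.
    refine ⟨φ, hφ, fun k => {x | δ / 2 * (φ k + 1) < |χ ((f k).1 x)|}, fun k => ?_,
      fun k a ha => ?_, fun x => ?_⟩
    · exact isOpen_lt continuous_const
        (χ.continuous.comp (hE.continuous _ (f k).2)).abs
    · have hpos : (0 : ℝ) < δ * (φ k + 1) := by positivity
      have := hge k a ha
      change δ / 2 * (φ k + 1) < _
      linarith
    · have hc : Continuous fun g : E => |χ (g.1 x)| :=
        (χ.continuous.comp ((continuous_apply x).comp continuous_subtype_val)).abs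
      obtain ⟨M, hM⟩ := (hK.image hc).bddAbove
      obtain ⟨N, hN⟩ := exists_nat_gt (M / (δ / 2))
      refine (finite_lt_nat N).subset fun k hk => ?_
      have h1 : δ / 2 * (φ k + 1) < |χ ((f k).1 x)| := hk
      have h2 := hM (mem_image_of_mem _ (hfK k))
      have h3 : (φ k : ℝ) + 1 < M / (δ / 2) := by
        rw [lt_div_iff₀ (half_pos hδ)]
        linarith
      have h4 : (k : ℝ) ≤ φ k := by exact_mod_cast hφ.id_le k
      have : (k : ℝ) < N := by linarith
      exact_mod_cast this

/-- If `X` has property `(κ)`, then all powers of `E` are `κ`-Fréchet–Urysohn. -/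
theorem IsInterpolative.isKappaFrechetUrysohn_pi [T35Space X] [IsTopologicalAddGroup Y]
    [ContinuousSMul ℝ Y] [FirstCountableTopology Y] {E : Set (X → Y)} (hE : IsInterpolative E)
    (hX : PropertyKappa X) (ι : Type*) : IsKappaFrechetUrysohn (ι → E) := by
  classical
  intro U hU p hp
  obtain ⟨V, hV, hVb⟩ := (nhds_basis_balanced ℝ Y).exists_antitone_subbasis
  choose! I D hID using fun (f : ι → E) (hf : f ∈ U) => exists_finset_forall_eqOn_mem_pi hU hf
  have hnear : ∀ (n : ℕ) (S : Finset ι × Finset X), ∃ f ∈ U, ∀ i ∈ S.1, ∀ x ∈ S.2,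
      (f i).1 x - (p i).1 x ∈ interior (V n) := by
    intro n S
    have hev : ∀ᶠ f : ι → E in 𝓝 p, ∀ i ∈ S.1, ∀ x ∈ S.2,
        (f i).1 x - (p i).1 x ∈ interior (V n) := by
      rw [Filter.eventually_all_finset]
      intro i _
      rw [Filter.eventually_all_finset]
      intro x _
      have hc : Continuous fun f : ι → E => (f i).1 x - (p i).1 x :=
        Continuous.sub ((continuous_apply x).comp
          ((continuous_subtype_val (p := (· ∈ E))).comp (continuous_apply i))) continuous_const
      refine hc.tendsto p (isOpen_interior.mem_nhds ?_)
      rw [sub_self]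
      exact mem_interior_iff_mem_nhds.2 (hV n).1
    obtain ⟨f, hf, hfU⟩ := (mem_closure_iff_frequently.1 hp).and_eventually hev |>.exists
    exact ⟨f, hf, hfU⟩
  choose F hFU hFV using hnear
  -- Stage `n + 1` adjoins the coordinates and points that decide membership of `F n (S n)` in `U`.
  -- Property `(κ)` is applied to the newly adjoined points.
  let S : ℕ → Finset ι × Finset X := fun n =>
    n.rec (∅, ∅) fun n s => (s.1 ∪ I (F n s), s.2 ∪ D (F n s))
  have hS1 : ∀ n, (S (n + 1)).1 = (S n).1 ∪ I (F n (S n)) := fun _ => rfl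
  have hS2 : ∀ n, (S (n + 1)).2 = (S n).2 ∪ D (F n (S n)) := fun _ => rfl
  have hm1 : Monotone fun n => (S n).1 :=
    monotone_nat_of_le_succ fun n => by rw [hS1]; exact Finset.subset_union_left
  have hm2 : Monotone fun n => (S n).2 :=
    monotone_nat_of_le_succ fun n => by rw [hS2]; exact Finset.subset_union_left
  obtain ⟨φ, hφ, O, hOo, hAO, hOf⟩ := hX (fun n => ↑((S (n + 1)).2 \ (S n).2))
    (fun n => Finset.finite_toSet _) (by
      rw [pairwise_disjoint_on]
      intro m n hmn
      rw [Finset.disjoint_coe, Finset.disjoint_left]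
      intro x hx hx'
      exact (Finset.mem_sdiff.1 hx').2 (hm2 (Nat.succ_le_of_lt hmn) (Finset.mem_sdiff.1 hx).1))
  let f : ℕ → ι → E := fun j => F (φ j) (S (φ j))
  -- Old points lie in `W j` because `f j` is close to `p` there; new points lie in `O j`.
  let W : ℕ → Set X := fun j =>
    ⋂ i ∈ (S (φ j)).1, {x | (f j i).1 x - (p i).1 x ∈ interior (V (φ j))}
  have hWo : ∀ j, IsOpen (W j) := fun j => isOpen_biInter_finset fun i _ =>
    isOpen_interior.preimage ((hE.continuous _ (f j i).2).sub (hE.continuous _ (p i).2))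
  have hsub : ∀ j, ((S (φ j + 1)).2 : Set X) ⊆ O j ∪ W j := by
    intro j x hx
    by_cases hx' : x ∈ (S (φ j)).2
    · exact Or.inr (mem_iInter₂.2 fun i hi => hFV _ _ i hi x hx')
    · exact Or.inl (hAO j (Finset.mem_coe.2 (Finset.mem_sdiff.2 ⟨hx, hx'⟩)))
  choose ψ hψc hψI hψ1 hψ0 using fun j =>
    exists_continuous_one_zero_of_finset_subset _ ((hOo j).union (hWo j)) (hsub j)
  -- `g j` equals `f j` on everything that decides membership in `U`. Outside `O j` it differs from
  -- `p`, in the coordinates of `S (φ j)`, by at most a scaled element of the balanced `V (φ j)`.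
  let g : ℕ → ι → E := fun j i => if i ∈ (S (φ j + 1)).1 then
    ⟨_, hE.interpolate_mem _ (f j i).2 _ (p i).2 (ψ j) (hψc j) (hψI j)⟩ else p i
  have hg : ∀ j i x, i ∈ (S (φ j + 1)).1 →
      (g j i).1 x = (p i).1 x + ψ j x • ((f j i).1 x - (p i).1 x) := by
    intro j i x hi
    simp only [g, if_pos hi]
  refine ⟨g, fun j => hID _ (hFU (φ j) (S (φ j))) _ fun i hi x hx => ?_, ?_⟩
  · have hi' : i ∈ (S (φ j + 1)).1 := by rw [hS1]; exact Finset.mem_union_right _ hi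
    have hx' : x ∈ (S (φ j + 1)).2 := by rw [hS2]; exact Finset.mem_union_right _ hx
    rw [hg j i x hi', hψ1 j x hx', one_smul, add_sub_cancel]
  · refine tendsto_pi_nhds.2 fun i => tendsto_subtype_rng.2 (tendsto_pi_nhds.2 fun x => ?_)
    rw [← tendsto_sub_nhds_zero_iff]
    refine hVb.tendsto_right_iff.2 fun k _ => ?_
    have hx : ∀ᶠ j in atTop, x ∉ O j := by
      rw [← Nat.cofinite_eq_atTop]
      exact (hOf x).eventually_cofinite_notMem
    have hk : ∀ᶠ j in atTop, k ≤ φ j := hφ.tendsto_atTop.eventually_ge_atTop k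
    have h0 : (0 : Y) ∈ V k := mem_of_mem_nhds (hV k).1
    -- Closeness on `W j` is known only for coordinates already in `S (φ j)`; a coordinate that
    -- enters at some stage is eventually there, and any other is never altered.
    by_cases hex : ∃ n, i ∈ (S n).1
    · obtain ⟨n, hn⟩ := hex
      filter_upwards [hx, hk, hφ.tendsto_atTop.eventually_ge_atTop n] with j hxj hkj hnj
      have hi : i ∈ (S (φ j)).1 := hm1 hnj hn
      rw [hg j i x (hm1 (Nat.le_succ _) hi), add_sub_cancel_left]
      by_cases hxW : x ∈ W j
      · have hmem : (f j i).1 x - (p i).1 x ∈ V k :=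
          hVb.antitone hkj (interior_subset (mem_iInter₂.1 hxW i hi))
        refine (hV k).2.smul_mem ?_ hmem
        rw [Real.norm_eq_abs, abs_of_nonneg (hψI j x).1]
        exact (hψI j x).2
      · rw [hψ0 j x (fun h => h.elim hxj hxW), zero_smul]
        exact h0
    · refine Eventually.of_forall fun j => ?_
      simp only [g, if_neg fun h => hex ⟨_, h⟩, sub_self]
      exact h0

/-! ### The equivalences and the real-valued case -/

theorem theoremt {𝕜 : Type u} [RCLike 𝕜]
    {X : Type v} [TopologicalSpace X] [T35Space X]
    {Y : Type w} [AddCommGroup Y] [Module 𝕜 Y] [Module ℝ Y] [IsScalarTower ℝ 𝕜 Y]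
    [TopologicalSpace Y] [IsTopologicalAddGroup Y] [ContinuousSMul 𝕜 Y] [LocallyConvexSpace ℝ Y]
    [TopologicalSpace.MetrizableSpace Y] [Nontrivial Y] :
    (∀ E : Set (X → Y), (E = Cp X Y ∨ E = Cpb 𝕜 X Y ∨ E = Cprc X Y) →
      List.TFAE [
        IsKappaFrechetUrysohn E,
        ∀ (ι : Type z) [Nonempty ι], IsKappaFrechetUrysohn (ι → E),
        IsAscoli E,
        ∀ (ι : Type z) [Nonempty ι], IsAscoli (ι → E),
        IsSequentiallyAscoli E,
        ∀ (ι : Type z) [Nonempty ι], IsSequentiallyAscoli (ι → E),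
        Finite X ∨ PropertyKappa X,
        ∃ (ι : Type z) (_ : Nonempty ι), IsKappaFrechetUrysohn (ι → E),
        ∃ (ι : Type z) (_ : Nonempty ι), IsAscoli (ι → E),
        ∃ (ι : Type z) (_ : Nonempty ι), IsSequentiallyAscoli (ι → E)]) ∧
    (IsSequentiallyAscoli (Cp X ℝ) ↔ PropertyKappa X) := by

  have : ContinuousSMul ℝ Y := IsScalarTower.continuousSMul 𝕜
  refine ⟨fun E hE => ?_, fun h => isInterpolative_Cp.propertyKappa h, fun h =>
    (isInterpolative_Cp.isKappaFrechetUrysohn_pi h Unit).of_pi.isAscoli.isSequentiallyAscoli⟩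
  have hI : IsInterpolative E := by
    rcases hE with rfl | rfl | rfl
    exacts [isInterpolative_Cp, isInterpolative_Cpb, isInterpolative_Cprc]
  tfae_have 1 → 3 := fun h => h.isAscoli
  tfae_have 3 → 5 := fun h => h.isSequentiallyAscoli
  tfae_have 5 → 7 := fun h => Or.inr (hI.propertyKappa h)
  tfae_have 7 → 2 := fun h ι _ =>
    hI.isKappaFrechetUrysohn_pi (h.elim (fun _ => Finite.propertyKappa) id) ι
  tfae_have 2 → 1 := fun h => (h PUnit).of_pi
  tfae_have 2 → 4 := fun h ι _ => (h ι).isAscoli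
  tfae_have 4 → 6 := fun h ι _ => (h ι).isSequentiallyAscoli
  tfae_have 6 → 10 := fun h => ⟨PUnit, inferInstance, h PUnit⟩
  -- The weakest assertion, about a single power, returns to `E` by retraction and so closes every
  -- cycle.
  tfae_have 10 → 5 := fun ⟨_, _, h⟩ => h.of_pi
  tfae_have 2 → 8 := fun h => ⟨PUnit, inferInstance, h PUnit⟩
  tfae_have 8 → 9 := fun ⟨ι, hι, h⟩ => ⟨ι, hι, h.isAscoli⟩
  tfae_have 9 → 10 := fun ⟨ι, hι, h⟩ => ⟨ι, hι, h.isSequentiallyAscoli⟩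
  tfae_finish
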